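/- **Threshold Direct Product Theorem.** For $X\subseteq\{0,1\}^d$ and a relation assigning to every $x\in X$ a set $A(x)$ of correct outputs, let $\mathrm{R}_\gamma(A)$ denote its worst-case randomized query complexity for success probability $\gamma$: the minimum, over all randomized algorithms (probability distributions over deterministic decision trees querying bits of the input) that on every input $x\in X$ output an element of $A(x)$ with probability at least $\gamma$, of the maximum number of queries made over all inputs $x\in X$ and all decision trees in the support of the algorithm. For a possibly partial Boolean function $f\colon X\to\{0,1\}$ write $\mathrm{R}_\gamma(f)$ for the case $A(x)=\{f(x)\}$, and $\mathrm{R}(f)=\mathrm{R}_{2/3}(f)$. For integers $n\ge 1$ and $k\le n$ let $\mathrm{Thr}^n_k\circ f$ be the relation that assigns to $(x^{(1)},\dots,x^{(n)})\in X^n$ the set of all $z\in\{0,1\}^n$ with $|\{i\in[n] : z_i=f(x^{(i)})\}|\ge k$. There exist universal constants $c\in(\tfrac12,1)$ and $C>0$ such that for every $m$, every (possibly partial) function $f\colon X\to\{0,1\}$ with $X\subseteq\{0,1\}^m$, all integers $n, k$ with $\tfrac n2<k\le n$, and every $\gamma\in[c,1)$, if $$\tau_{n,k}=\log_2\left(\frac{2^n}{\sum_{i=0}^{n-k}\binom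 ni}\right),$$ then $$\mathrm{R}_{\gamma^{\tau_{n,k}}}\left(\mathrm{Thr}^n_k\circ f\right)\ \ge\ C\,\tau_{n,k}\,\mathrm{R}(f).$$ -/

import Mathlib

/-- A deterministic decision tree reading input bits indexed by `ι` and producing an output in `O`.
The internal node `query i t₀ t₁` reads bit `i` and continues in `t₀` if it is `0`, in `t₁` if it
is `1`. -/
inductive DecisionTree (ι O : Type) : Type
  | leaf (o : O) : DecisionTree ι O
  | query (i : ι) (t₀ t₁ : DecisionTree ι O) : DecisionTree ι O

namespace DecisionTree

variable {ι O : Type}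

/-- The label of the leaf reached by the input `x`. -/
def eval (x : ι → Bool) : DecisionTree ι O → O
  | leaf o => o
  | query i t₀ t₁ => if x i then t₁.eval x else t₀.eval x

/-- The depth of the leaf reached by the input `x`, that is, the number of queries made on `x`. -/
def cost (x : ι → Bool) : DecisionTree ι O → ℕ
  | leaf _ => 0
  | query i t₀ t₁ => (if x i then t₁.cost x else t₀.cost x) + 1

end DecisionTree

/-- A randomized algorithm is a probability distribution over deterministic decision trees. (There
are only countably many decision trees over finite `ι` and `O`.) -/
abbrev RandomizedAlgorithm (ι O : Type) : Type := PMF (DecisionTree ι O)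

namespace RandomizedAlgorithm

variable {ι O : Type}

/-- The probability, over the internal randomness of `R`, that the output of `R` on input `x` lies
in the set `A` of correct outputs. -/
noncomputable def successProb (R : RandomizedAlgorithm ι O) (x : ι → Bool) (A : Set O) : ℝ :=
  (R.toOuterMeasure {D | D.eval x ∈ A}).toReal

/-- The worst-case cost of `R` on the domain `X`: the maximum of the number of queries, over the
inputs in `X` and over the trees in the support of `R`. It is `⊤` if that number is unbounded. -/
noncomputable def cost (R : RandomizedAlgorithm ι O) (X : Set (ι → Bool)) : ℕ∞ :=
  ⨆ x ∈ X, ⨆ D ∈ R.support, (D.cost x : ℕ∞)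

/-- `R` computes the relation `rel` with success probability at least `γ` on every input of the
domain. -/
def Computes (R : RandomizedAlgorithm ι O) {X : Set (ι → Bool)} (rel : X → Set O) (γ : ℝ) : Prop :=
  ∀ x : X, γ ≤ R.successProb x (rel x)

end RandomizedAlgorithm

/-- The worst-case randomized query complexity, for success probability `γ`, of a relation with
domain `X ⊆ {0,1}^ι`: the least worst-case cost of a randomized algorithm that computes it with
success probability at least `γ` on every input in `X`. -/
noncomputable def randQueryComplexity {ι O : Type} {X : Set (ι → Bool)} (rel : X → Set O)
    (γ : ℝ) : ℕ :=
  sInf {d : ℕ | ∃ R : RandomizedAlgorithm ι O, R.Computes rel γ ∧ R.cost X ≤ d}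

/-- Over finitely many input bits there is a decision tree for every function. -/
theorem DecisionTree.exists_eval_eq {ι O : Type} [Fintype ι] (g : (ι → Bool) → O) :
    ∃ D : DecisionTree ι O, ∀ x, D.eval x = g x ∧ D.cost x ≤ Fintype.card ι := by
  classical
  have key : ∀ (l : List ι) (g : (ι → Bool) → O),
      (∀ x y : ι → Bool, (∀ i ∈ l, x i = y i) → g x = g y) →
      ∃ D : DecisionTree ι O, ∀ x, D.eval x = g x ∧ D.cost x ≤ l.length := by
    intro l
    induction l with
    | nil =>
      intro g hg
      exact ⟨.leaf (g fun _ => false), fun x => ⟨hg _ _ (by simp), le_rfl⟩⟩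
    | cons i l ih =>
      intro g hg
      have h : ∀ b : Bool, ∃ D : DecisionTree ι O, ∀ x,
          D.eval x = g (Function.update x i b) ∧ D.cost x ≤ l.length := by
        intro b
        apply ih (fun x => g (Function.update x i b))
        intro x y hxy
        apply hg
        intro j hj
        by_cases hji : j = i
        · subst hji; simp
        · have hjl : j ∈ l := by simpa [hji] using hj
          simp [hji, hxy j hjl]
      obtain ⟨D₀, h₀⟩ := h false
      obtain ⟨D₁, h₁⟩ := h true
      refine ⟨.query i D₀ D₁, fun x => ?_⟩
      have hu : g (Function.update x i (x i)) = g x := by simp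
      cases hx : x i
      · rw [hx] at hu
        simp [DecisionTree.eval, DecisionTree.cost, hx, (h₀ x).1, hu, (h₀ x).2]
      · rw [hx] at hu
        simp [DecisionTree.eval, DecisionTree.cost, hx, (h₁ x).1, hu, (h₁ x).2]
  obtain ⟨D, hD⟩ := key Finset.univ.toList g
    (fun x y h => congrArg g (funext fun i => h i (by simp)))
  exact ⟨D, fun x => by simpa using hD x⟩

/-- The minimum in the definition of `randQueryComplexity` is attained whenever every input has a
correct output and `γ ≤ 1`; so it is then the minimum of a nonempty set. -/
theorem randQueryComplexity_attained {ι O : Type} [Fintype ι] [Nonempty O] {X : Set (ι → Bool)}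
    (rel : X → Set O) (hrel : ∀ x, (rel x).Nonempty) {γ : ℝ} (hγ : γ ≤ 1) :
    ∃ R : RandomizedAlgorithm ι O,
      R.Computes rel γ ∧ R.cost X ≤ (randQueryComplexity rel γ : ℕ∞) := by
  classical
  refine Nat.sInf_mem
    (s := {d : ℕ | ∃ R : RandomizedAlgorithm ι O, R.Computes rel γ ∧ R.cost X ≤ d})
    ⟨Fintype.card ι, ?_⟩
  choose o ho using hrel
  obtain ⟨D, hD⟩ := DecisionTree.exists_eval_eq
    (fun x : ι → Bool => if h : x ∈ X then o ⟨x, h⟩ else Classical.arbitrary O)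
  refine ⟨PMF.pure D, fun x => ?_, ?_⟩
  · have hmem : D.eval x.1 ∈ rel x := by
      rw [(hD x.1).1]
      simpa using ho x
    simpa [RandomizedAlgorithm.successProb, PMF.toOuterMeasure_pure_apply, hmem] using hγ
  · refine iSup₂_le fun x _ => iSup₂_le fun D' hD' => ?_
    have hDD : D' = D := by simpa using hD'
    subst hDD
    exact_mod_cast (hD x).2

/-- `R_γ(f)` for a partial Boolean function `f : X → {0,1}`, `X ⊆ {0,1}^ι`. -/
noncomputable def randComplexityOfFun {ι : Type} {X : Set (ι → Bool)} (f : X → Bool) (γ : ℝ) : ℕ :=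
  randQueryComplexity (fun x => {f x}) γ

/-- `X^n ⊆ {0,1}^{n × m}`: the `n`-tuples all of whose entries `x⁽ⁱ⁾ = (x (i, j))_j` lie in `X`. -/
def productDomain {m : ℕ} (X : Set (Fin m → Bool)) (n : ℕ) : Set (Fin n × Fin m → Bool) :=
  {x | ∀ i, (fun j => x (i, j)) ∈ X}

/-- The function `f^n : X^n → {0,1}^n`, `(x⁽¹⁾, …, x⁽ⁿ⁾) ↦ (f x⁽¹⁾, …, f x⁽ⁿ⁾)`. -/
def productFun {m : ℕ} {X : Set (Fin m → Bool)} (f : X → Bool) (n : ℕ) :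
    productDomain X n → (Fin n → Bool) :=
  fun x i => f ⟨fun j => x.1 (i, j), x.2 i⟩

/-- The `k`-of-`n` threshold relation: the vectors that agree with `y` in at least `k` places. -/
def Thr (n k : ℕ) (y : Fin n → Bool) : Set (Fin n → Bool) :=
  {z | k ≤ (Finset.univ.filter fun i => y i = z i).card}

/-- `τ_{n,k} = log₂ (2^n / ∑_{i=0}^{n-k} C(n,i))`, used for `k ≤ n`. -/
noncomputable def tau (n k : ℕ) : ℝ :=
  Real.logb 2 (2 ^ n / ∑ i ∈ Finset.range (n - k + 1), (n.choose i : ℝ))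

/-!
A forecasting tree queries bits of `x` and then announces a forecast `a ∈ [-1, 1]` of the sign
`y = ±1` of `f x`. Its payoff is the quadratic score `2 a y - a ^ 2` minus a price `β` for each
query.

If some mixture of forecasting trees had positive payoff on every input, then running it again and
again, until the charge, the sum of `a ^ 2` and of the prices paid, exceeds a large constant, and
answering with the sign of the sum of the forecasts would err with small constant probability: the
exponential moment `𝔼 exp ((charge - 8 y ∑ a) / 64)` does not increase from round to round. This
makes `O(1 / β)` queries. So for `β` a suitable constant divided by `R(f)` no such mixture exists,
and the minimax theorem gives a distribution `μ` on which no forecasting tree has positive payoff on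
average.

To a weight `w` on the inputs associate its potential, the mass of `w` plus the largest payoff of a
forecasting tree against `w`. It is `1` for `μ`, a query splits a weight into two whose potentials
add up to at most `1 + β` times that of `w`, and the constant forecasts show that the squared masses
of the two labels add up to at most half of potential times mass. In a tree for the `n`-fold problem
under `μ ^ n` the weight at each node is a product. If every output is correct for at most `N` label
vectors, the Cauchy–Schwarz inequality at the leaves bounds the success probability after `q`
queries by `√((1 + β) ^ q * N / 2 ^ n)`. For the threshold relation `N / 2 ^ n = 2 ^ (-τ)`, so
success probability `γ ^ τ` with `γ > 1 / √2` requires `β q` to be at least of the order of `τ`.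
-/

namespace DecisionTree

variable {ι O : Type}

/-- The length of the longest path from the root to a leaf, whether or not an input follows it. -/
def depth : DecisionTree ι O → ℕ
  | leaf _ => 0
  | query _ t₀ t₁ => max t₀.depth t₁.depth + 1

theorem cost_le_depth (D : DecisionTree ι O) (x : ι → Bool) : D.cost x ≤ D.depth := by
  induction D with
  | leaf o => exact le_rfl
  | query i t₀ t₁ ih₀ ih₁ =>
    simp only [cost, depth]
    split_ifs <;> omega

/-- The tree cut at depth `d`, with output `o` on the paths that were cut. -/
def truncate (o : O) : ℕ → DecisionTree ι O → DecisionTree ι O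
  | _, leaf a => leaf a
  | 0, query _ _ _ => leaf o
  | d + 1, query i t₀ t₁ => query i (truncate o d t₀) (truncate o d t₁)

theorem depth_truncate_le (o : O) (d : ℕ) (D : DecisionTree ι O) : (D.truncate o d).depth ≤ d := by
  induction d generalizing D with
  | zero => cases D <;> simp [truncate, depth]
  | succ d ih =>
    cases D with
    | leaf a => simp [truncate, depth]
    | query i t₀ t₁ => simp [truncate, depth, ih]

theorem truncate_eq_or_lt_cost (o : O) (d : ℕ) (D : DecisionTree ι O) (x : ι → Bool) :
    ((D.truncate o d).eval x = D.eval x ∧ (D.truncate o d).cost x = D.cost x) ∨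
      (d < D.cost x ∧ (D.truncate o d).eval x = o ∧ (D.truncate o d).cost x = d) := by
  induction d generalizing D with
  | zero => cases D <;> simp [truncate, cost, eval]
  | succ d ih =>
    cases D with
    | leaf a => simp [truncate]
    | query i t₀ t₁ =>
      have h₀ := ih t₀
      have h₁ := ih t₁
      cases hx : x i <;> simpa [truncate, cost, eval, hx]

end DecisionTree

section Mixtures

variable {ι O : Type}

/-- The expected scores `x ↦ 𝔼 φ D x` of random decision trees `D` of depth at most `d`. A
randomized algorithm enters the argument only through this vector. -/
def mixedScores {κ : Type} (φ : DecisionTree ι O → κ → ℝ) (d : ℕ) : Set (κ → ℝ) :=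
  convexHull ℝ (φ '' {D | D.depth ≤ d})

theorem score_mem_mixedScores {κ : Type} (φ : DecisionTree ι O → κ → ℝ) {d : ℕ}
    {D : DecisionTree ι O} (hD : D.depth ≤ d) : φ D ∈ mixedScores φ d :=
  subset_convexHull ℝ _ ⟨D, hD, rfl⟩

theorem exists_weights_of_mem_mixedScores {κ : Type} {φ : DecisionTree ι O → κ → ℝ} {d : ℕ}
    {v : κ → ℝ} (hv : v ∈ mixedScores φ d) :
    ∃ (J : Type) (_ : Fintype J) (w : J → ℝ) (D : J → DecisionTree ι O), (∀ j, 0 ≤ w j) ∧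
      ∑ j, w j = 1 ∧ (∀ j, (D j).depth ≤ d) ∧ ∀ x, v x = ∑ j, w j * φ (D j) x := by
  obtain ⟨J, _, w, z, hw, hw1, hz, rfl⟩ := mem_convexHull_iff_exists_fintype.mp hv
  choose D hD hzD using hz
  exact ⟨J, ‹_›, w, D, hw, hw1, hD, fun x => by simp [← hzD, Finset.sum_apply]⟩

variable {X : Set (ι → Bool)}

/-- The indicator of a wrong output, as a vector indexed by the domain of the relation, so that its
mixtures are the error probabilities of randomized algorithms. -/
noncomputable def errorIndicator (rel : X → Set O) (D : DecisionTree ι O) (x : X) : ℝ :=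
  (rel x)ᶜ.indicator 1 (D.eval x)

theorem ite_mem_mixedScores_errorIndicator {rel : X → Set O} {r : ℕ} (i : ι) {u₀ u₁ : X → ℝ}
    (h₀ : u₀ ∈ mixedScores (errorIndicator rel) r) (h₁ : u₁ ∈ mixedScores (errorIndicator rel) r) :
    (fun x : X => if x.1 i then u₁ x else u₀ x) ∈ mixedScores (errorIndicator rel) (r + 1) := by
  let branch : (X → ℝ) × (X → ℝ) →ₗ[ℝ] (X → ℝ) :=
    { toFun := fun p x => if x.1 i then p.2 x else p.1 x
      map_add' := fun p q => by ext x; cases h : x.1 i <;> simp [h]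
      map_smul' := fun c p => by ext x; cases h : x.1 i <;> simp [h] }
  let S := errorIndicator rel '' {D | D.depth ≤ r}
  have hmem : (u₀, u₁) ∈ convexHull ℝ (S ×ˢ S) := by
    rw [convexHull_prod]
    exact ⟨h₀, h₁⟩
  have himage : branch '' (S ×ˢ S) ⊆ errorIndicator rel '' {D | D.depth ≤ r + 1} := by
    rintro _ ⟨_, ⟨⟨D₀, hD₀, h₀⟩, ⟨D₁, hD₁, h₁⟩⟩, rfl⟩
    refine ⟨.query i D₀ D₁, by simpa [DecisionTree.depth] using ⟨hD₀, hD₁⟩, ?_⟩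
    ext x
    cases hx : x.1 i <;> simp [branch, ← h₀, ← h₁, errorIndicator, DecisionTree.eval, hx]
  refine convexHull_mono himage ?_
  rw [← branch.image_convexHull]
  exact ⟨_, hmem, rfl⟩

theorem graft_mem_mixedScores_errorIndicator {O' : Type} {rel : X → Set O}
    (D : DecisionTree ι O') {r : ℕ} (hD : D.depth ≤ r) (u : O' → ℕ → X → ℝ)
    (hu : ∀ a, ∀ q ≤ D.depth, u a q ∈ mixedScores (errorIndicator rel) (r - q)) :
    (fun x : X => u (D.eval x) (D.cost x) x) ∈ mixedScores (errorIndicator rel) r := by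
  induction D generalizing r u with
  | leaf a => simpa [DecisionTree.eval, DecisionTree.cost] using hu a 0 le_rfl
  | query i t₀ t₁ ih₀ ih₁ =>
    simp only [DecisionTree.depth] at hD hu
    obtain ⟨r, rfl⟩ : ∃ r', r = r' + 1 := ⟨r - 1, by omega⟩
    have hu' : ∀ a, ∀ q ≤ max t₀.depth t₁.depth,
        u a (q + 1) ∈ mixedScores (errorIndicator rel) (r - q) := fun a q hq => by
      simpa using hu a (q + 1) (by omega)
    have h₀ := ih₀ (r := r) (by omega) (fun a q => u a (q + 1)) fun a q hq => hu' a q (by omega)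
    have h₁ := ih₁ (r := r) (by omega) (fun a q => u a (q + 1)) fun a q hq => hu' a q (by omega)
    convert ite_mem_mixedScores_errorIndicator i h₀ h₁ using 1
    ext x
    cases hx : x.1 i <;> simp [DecisionTree.eval, DecisionTree.cost, hx]

theorem exists_randomizedAlgorithm_of_mem_mixedScores {rel : X → Set O} {r : ℕ} {v : X → ℝ}
    (hv : v ∈ mixedScores (errorIndicator rel) r) :
    ∃ R : RandomizedAlgorithm ι O,
      (∀ x : X, R.successProb x (rel x) = 1 - v x) ∧ R.cost X ≤ r := by
  classical
  obtain ⟨J, _, w, D, hw, hw1, hD, hv⟩ := exists_weights_of_mem_mixedScores hv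
  have hsum : ∑ j, ENNReal.ofReal (w j) = 1 := by
    rw [← ENNReal.ofReal_sum_of_nonneg (fun j _ => hw j), hw1, ENNReal.ofReal_one]
  refine ⟨(PMF.ofFintype (fun j => ENNReal.ofReal (w j)) hsum).map D, fun x => ?_, ?_⟩
  · have hsucc : 1 - v x = ∑ j, if (D j).eval x ∈ rel x then w j else 0 := by
      rw [hv, ← hw1, ← Finset.sum_sub_distrib]
      refine Finset.sum_congr rfl fun j _ => ?_
      by_cases hj : (D j).eval x ∈ rel x <;> simp [errorIndicator, hj]
    rw [hsucc, RandomizedAlgorithm.successProb, PMF.toOuterMeasure_map_apply,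
      PMF.toOuterMeasure_apply_fintype, ENNReal.toReal_sum]
    · refine Finset.sum_congr rfl fun j _ => ?_
      by_cases hj : (D j).eval x ∈ rel x <;> simp [hj, hw j]
    · intro j _
      by_cases hj : (D j).eval x ∈ rel x <;> simp [hj]
  · refine iSup₂_le fun x _ => iSup₂_le fun D' hD' => ?_
    obtain ⟨j, -, rfl⟩ := (PMF.mem_support_map_iff _ _ _).mp hD'
    exact_mod_cast ((D j).cost_le_depth x).trans (hD j)

theorem randQueryComplexity_le_of_mem_mixedScores {rel : X → Set O} {r : ℕ} {v : X → ℝ} {γ : ℝ}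
    (hv : v ∈ mixedScores (errorIndicator rel) r) (hvγ : ∀ x, v x ≤ 1 - γ) :
    randQueryComplexity rel γ ≤ r := by
  obtain ⟨R, hR, hcost⟩ := exists_randomizedAlgorithm_of_mem_mixedScores hv
  exact Nat.sInf_le ⟨R, fun x => by linarith [hR x, hvγ x], hcost⟩

end Mixtures

section Forecasts

variable {ι : Type}

/-- The label `b` as a sign, the quantity that forecasting trees predict. -/
def boolSign (b : Bool) : ℝ := if b then 1 else -1

theorem boolSign_sq (b : Bool) : boolSign b ^ 2 = 1 := by cases b <;> norm_num [boolSign]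

/-- A decision tree whose output is a forecast of the sign of the label. -/
abbrev ForecastTree (ι : Type) : Type := DecisionTree ι (Set.Icc (-1 : ℝ) 1)

/-- The forecast that expresses complete ignorance. -/
def zeroForecast : Set.Icc (-1 : ℝ) 1 := ⟨0, by norm_num, by norm_num⟩

/-- The quadratic score of the forecast for the label `b`, normalized so that `zeroForecast` scores
`0`, minus a price `β` for each query. -/
noncomputable def forecastPayoff (β : ℝ) (D : ForecastTree ι) (x : ι → Bool) (b : Bool) : ℝ :=
  2 * (D.eval x).1 * boolSign b - (D.eval x).1 ^ 2 - β * D.cost x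

theorem forecastPayoff_le {β : ℝ} (hβ : 0 ≤ β) (D : ForecastTree ι) (x : ι → Bool) (b : Bool) :
    forecastPayoff β D x b ≤ 1 := by
  have : 0 ≤ β * D.cost x := by positivity
  unfold forecastPayoff
  nlinarith [sq_nonneg ((D.eval x).1 - boolSign b), boolSign_sq b]

theorem forecastPayoff_le_truncate {β : ℝ} {d : ℕ} (hd : 2 ≤ β * (d + 1))
    (D : ForecastTree ι) (x : ι → Bool) (b : Bool) :
    forecastPayoff β D x b ≤ forecastPayoff (β / 2) (D.truncate zeroForecast d) x b := by
  have hβ : 0 < β := pos_of_mul_pos_left (by linarith) (by positivity : (0 : ℝ) ≤ d + 1)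
  unfold forecastPayoff
  rcases D.truncate_eq_or_lt_cost zeroForecast d x with ⟨heval, hcost⟩ | ⟨hlt, heval, hcost⟩
  · rw [heval, hcost]
    have : 0 ≤ β * D.cost x := by positivity
    linarith
  · rw [heval, hcost]
    have hcost_ge : (d : ℝ) + 1 ≤ D.cost x := by exact_mod_cast hlt
    have := mul_le_mul_of_nonneg_left hcost_ge hβ.le
    simp only [zeroForecast]
    nlinarith [sq_nonneg ((D.eval x).1 - boolSign b), boolSign_sq b]

/-- The payoff of a forecasting tree for the labels `f`, as a vector indexed by the domain. -/
noncomputable def payoffVector {X : Set (ι → Bool)} (β : ℝ) (f : X → Bool) (D : ForecastTree ι)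
    (x : X) : ℝ :=
  forecastPayoff β D x (f x)

end Forecasts

section Amplification

variable {ι : Type} {X : Set (ι → Bool)}

theorem exp_le_one_add_add_sq {t : ℝ} (ht : |t| ≤ 1) : Real.exp t ≤ 1 + t + t ^ 2 := by
  linarith [(abs_le.mp (Real.abs_exp_sub_one_sub_id_le ht)).2]

theorem exp_sub_eight_mul_div_le {p h : ℝ} (hp : |p| ≤ 1) (hph : p ^ 2 ≤ h) (hh : h ≤ 3) :
    Real.exp ((h - 8 * p) / 64) ≤ 1 - (2 * p - h) / 16 := by
  have hh0 : 0 ≤ h := (sq_nonneg p).trans hph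
  obtain ⟨hp₁, hp₂⟩ := abs_le.mp hp
  have ht : |(h - 8 * p) / 64| ≤ 1 := abs_le.mpr ⟨by linarith, by linarith⟩
  have hhsq : h ^ 2 ≤ 3 * h := by nlinarith
  refine (exp_le_one_add_add_sq ht).trans ?_
  nlinarith [sq_nonneg (p + h / 8)]

theorem exp_forecast_le {β ε : ℝ} {d : ℕ} (hβ : 0 ≤ β) (hd : β * d ≤ 1) (hε : 0 ≤ ε) (hε1 : ε ≤ 1)
    {D : ForecastTree ι} (hD : D.depth ≤ d) (x : ι → Bool) (b : Bool) :
    Real.exp (((D.eval x).1 ^ 2 + β * D.cost x + ε - 8 * ((D.eval x).1 * boolSign b)) / 64) ≤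
      1 - (forecastPayoff β D x b - ε) / 16 := by
  have hcost : β * D.cost x ≤ β * d :=
    mul_le_mul_of_nonneg_left (by exact_mod_cast (D.cost_le_depth x).trans hD) hβ
  have hcost0 : 0 ≤ β * D.cost x := by positivity
  have hp : ((D.eval x).1 * boolSign b) ^ 2 = (D.eval x).1 ^ 2 := by
    rw [mul_pow, boolSign_sq, mul_one]
  have ha : (D.eval x).1 ^ 2 ≤ 1 := sq_le_one_iff_abs_le_one _ |>.mpr (abs_le.mpr (D.eval x).2)
  refine (exp_sub_eight_mul_div_le ?_ ?_ ?_).trans_eq ?_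
  · rwa [← sq_le_one_iff_abs_le_one, hp]
  · linarith
  · linarith
  · unfold forecastPayoff
    ring

/-- The error bound for the label `b` when the forecasts made so far sum to `s` and `A` is the
charge so far minus its target: every forecast `a` adds about `a ^ 2` plus its query costs to the
charge, and it exceeds the target when the forecasting stops. -/
noncomputable def errorBound (s A : ℝ) (b : Bool) : ℝ :=
  Real.exp ((A - 8 * (s * boolSign b)) / 64)

theorem errorBound_add (s A a h : ℝ) (b : Bool) :
    errorBound (s + a) (A + h) b =
      errorBound s A b * Real.exp ((h - 8 * (a * boolSign b)) / 64) := by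
  rw [errorBound, errorBound, ← Real.exp_add]
  ring_nf

theorem exists_le_errorBound_of_nonneg (f : X → Bool) (r : ℕ) (s : ℝ) {A : ℝ} (hA : 0 ≤ A) :
    ∃ u ∈ mixedScores (errorIndicator fun x : X => {f x}) r, ∀ x, u x ≤ errorBound s A (f x) := by
  refine ⟨_, score_mem_mixedScores _ (D := .leaf (decide (0 ≤ s))) (Nat.zero_le r), fun x => ?_⟩
  by_cases hright : decide (0 ≤ s) ∈ ({f x} : Set Bool)
  · exact (Set.indicator_of_notMem (not_not.mpr hright) _).trans_le (Real.exp_pos _).le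
  have hs : s * boolSign (f x) ≤ 0 := by
    rcases le_or_gt 0 s with h | h <;> cases hx : f x <;>
      simp_all [boolSign, not_le.mpr, le_of_lt]
  exact (Set.indicator_of_mem hright _).trans_le (Real.one_le_exp (by linarith))

theorem exists_le_of_forecast_round {f : X → Bool} {β ε : ℝ} {d r : ℕ} (hβ : 0 ≤ β)
    (hd : β * d ≤ 1) (hdr : d ≤ r) (hε : 0 ≤ ε) (hε1 : ε ≤ 1) {v : X → ℝ}
    (hv : v ∈ mixedScores (payoffVector β f) d) (hvε : ∀ x, ε ≤ v x)
    {E : X → ℝ} (hE : ∀ x, 0 ≤ E x)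
    (hround : ∀ a : Set.Icc (-1 : ℝ) 1, ∀ q ≤ d,
      ∃ u ∈ mixedScores (errorIndicator fun x : X => {f x}) (r - q), ∀ x,
        u x ≤ E x * Real.exp ((a.1 ^ 2 + β * q + ε - 8 * (a.1 * boolSign (f x))) / 64)) :
    ∃ u ∈ mixedScores (errorIndicator fun x : X => {f x}) r, ∀ x, u x ≤ E x := by
  obtain ⟨J, _, w, D, hw, hw1, hD, hv⟩ := exists_weights_of_mem_mixedScores hv
  choose! u hu hux using hround
  refine ⟨∑ j, w j • fun x : X => u ((D j).eval x) ((D j).cost x) x,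
    (convex_convexHull ℝ _).sum_mem (fun j _ => hw j) hw1 fun j _ =>
      graft_mem_mixedScores_errorIndicator (D j) ((hD j).trans hdr) u
        fun a q hq => hu a q (hq.trans (hD j)), fun x => ?_⟩
  have hterm : ∀ j, u ((D j).eval x) ((D j).cost x) x ≤
      E x * (1 - (forecastPayoff β (D j) x (f x) - ε) / 16) := fun j =>
    (hux _ _ (((D j).cost_le_depth x).trans (hD j)) x).trans
      (mul_le_mul_of_nonneg_left (exp_forecast_le hβ hd hε hε1 (hD j) x (f x)) (hE x))
  calc (∑ j, w j • fun x : X => u ((D j).eval x) ((D j).cost x) x) x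
      = ∑ j, w j * u ((D j).eval x) ((D j).cost x) x := by simp [Finset.sum_apply]
    _ ≤ ∑ j, w j * (E x * (1 - (forecastPayoff β (D j) x (f x) - ε) / 16)) :=
        Finset.sum_le_sum fun j _ => mul_le_mul_of_nonneg_left (hterm j) (hw j)
    _ = E x * ((∑ j, w j) * (1 + ε / 16) - (∑ j, w j * payoffVector β f (D j) x) / 16) := by
        simp only [payoffVector]
        rw [Finset.sum_mul, Finset.sum_div, ← Finset.sum_sub_distrib, Finset.mul_sum]
        exact Finset.sum_congr rfl fun j _ => by ring
    _ ≤ E x * 1 := by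
        refine mul_le_mul_of_nonneg_left ?_ (hE x)
        rw [hw1, ← hv]
        linarith [hvε x]
    _ = E x := mul_one _

theorem exists_le_errorBound {f : X → Bool} {β ε : ℝ} {d : ℕ} (hβ : 0 < β) (hd : β * d ≤ 1)
    (hε : 0 ≤ ε) (hε1 : ε ≤ 1) {v : X → ℝ}
    (hv : v ∈ mixedScores (payoffVector β f) d) (hvε : ∀ x, ε ≤ v x)
    (N : ℕ) {s A : ℝ} {r : ℕ} (hN : 0 ≤ A + N * ε) (hr : 3 - A < β * (r + 1)) :
    ∃ u ∈ mixedScores (errorIndicator fun x : X => {f x}) r, ∀ x, u x ≤ errorBound s A (f x) := by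
  induction N generalizing s A r with
  | zero => exact exists_le_errorBound_of_nonneg f r s (by simpa using hN)
  | succ N ih =>
    rcases le_or_gt 0 A with hA | hA
    · exact exists_le_errorBound_of_nonneg f r s hA
    have hdr : d ≤ r := by
      by_contra! hlt
      have hrd : (r : ℝ) + 1 ≤ d := by exact_mod_cast hlt
      linarith [mul_le_mul_of_nonneg_left hrd hβ.le]
    refine exists_le_of_forecast_round hβ.le hd hdr hε hε1 hv hvε (fun x => (Real.exp_pos _).le)
      fun a q hq => ?_
    have hβq : 0 ≤ β * q := by positivity
    have ha : 0 ≤ a.1 ^ 2 := sq_nonneg a.1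
    simp only [← errorBound_add]
    refine ih ?_ ?_
    · push_cast at hN
      linarith
    · rw [Nat.cast_sub (hq.trans hdr)]
      linarith

/-- The charge target is `B`; the slack `3` is the most that one round can charge. -/
theorem mul_randComplexityOfFun_le {f : X → Bool} {β ε B γ : ℝ} {d : ℕ} (hβ : 0 < β)
    (hd : β * d ≤ 1) (hε : 0 < ε) {v : X → ℝ}
    (hv : v ∈ mixedScores (payoffVector β f) d) (hvε : ∀ x, ε ≤ v x)
    (hB : 0 ≤ B) (hγ : Real.exp (-B / 64) ≤ 1 - γ) :
    β * randComplexityOfFun f γ ≤ B + 3 := by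
  have hδ : 0 < min ε 1 := lt_min hε one_pos
  obtain ⟨N, hN⟩ := exists_nat_ge (B / min ε 1)
  rw [div_le_iff₀ hδ] at hN
  obtain ⟨u, hu, hux⟩ := exists_le_errorBound (s := 0) (A := -B) (r := ⌊(B + 3) / β⌋₊) hβ hd hδ.le
    (min_le_right _ _) hv (fun x => (min_le_left _ _).trans (hvε x)) N (by linarith) (by
      rw [sub_neg_eq_add, add_comm, ← div_lt_iff₀' hβ]
      exact Nat.lt_floor_add_one _)
  have hle := randQueryComplexity_le_of_mem_mixedScores hu fun x => (hux x).trans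
    (by simpa [errorBound] using hγ)
  rw [← le_div_iff₀' hβ]
  exact (Nat.le_floor_iff (by positivity)).mp hle

end Amplification

section Minimax

theorem exists_mem_stdSimplex_forall_dotProduct_nonpos {κ : Type*} [Fintype κ] {K : Set (κ → ℝ)}
    (hK : Convex ℝ K) (hne : K.Nonempty) (hnonpos : ∀ v ∈ K, ∃ x, v x ≤ 0) :
    ∃ μ ∈ stdSimplex ℝ κ, ∀ v ∈ K, μ ⬝ᵥ v ≤ 0 := by
  classical
  by_contra! hpos
  have hcont : ∀ v ∈ K, LowerSemicontinuousOn (· ⬝ᵥ v) (stdSimplex ℝ κ) := fun v _ =>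
    Continuous.lowerSemicontinuous (by fun_prop) |>.lowerSemicontinuousOn _
  obtain ⟨s, hs⟩ : ∃ s : Finset K, ∀ μ ∈ stdSimplex ℝ κ, ∃ v ∈ s, 0 < μ ⬝ᵥ v.1 := by
    rw [← LowerSemicontinuousOn.inter_biInter_preimage_Iic_eq_empty_iff_exists_finset
      (isCompact_stdSimplex ℝ κ) hcont]
    refine Set.eq_empty_of_forall_notMem fun μ hμ => ?_
    obtain ⟨v, hv, hμv⟩ := hpos μ hμ.1
    exact hμv.not_ge (Set.mem_iInter₂.mp hμ.2 v hv)
  obtain ⟨v₀, hv₀⟩ := hne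
  obtain ⟨x₀, -⟩ := hnonpos v₀ hv₀
  obtain ⟨v, hv, hvpos⟩ := Sion.exists_lt_iInf_of_lt_iInf_of_finite (t := 0)
    (f := fun μ v : κ → ℝ => μ ⬝ᵥ v)
    ⟨_, single_mem_stdSimplex ℝ x₀⟩ (isCompact_stdSimplex ℝ κ) hcont
    (fun v _ => ((dotProductBilin ℝ ℝ).flip v).convexOn (convex_stdSimplex ℝ κ) |>.quasiconvexOn) hK
    (fun μ _ => Continuous.upperSemicontinuous (by fun_prop) |>.upperSemicontinuousOn _)
    (fun μ _ => (dotProductBilin ℝ ℝ μ).concaveOn hK |>.quasiconcaveOn) (convex_stdSimplex ℝ κ)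
    (s.finite_toSet.image Subtype.val) (Subtype.coe_image_subset K s) fun μ hμ => by
      obtain ⟨v, hv, hμv⟩ := hs μ hμ
      exact ⟨v, ⟨v, hv, rfl⟩, hμv⟩
  obtain ⟨x, hx⟩ := hnonpos v hv
  have := hvpos _ (single_mem_stdSimplex ℝ x)
  rw [single_one_dotProduct] at this
  exact hx.not_gt this

end Minimax

section HardDistribution

variable {ι : Type} {X : Set (ι → Bool)}

theorem exists_payoffVector_nonpos {f : X → Bool} {β B γ : ℝ} {d : ℕ} (hβ : 0 < β)
    (hd : β * d ≤ 1) (hB : 0 ≤ B) (hγ : Real.exp (-B / 64) ≤ 1 - γ)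
    [Finite X] (hR : B + 3 < β * randComplexityOfFun f γ)
    {v : X → ℝ} (hv : v ∈ mixedScores (payoffVector β f) d) : ∃ x, v x ≤ 0 := by
  by_contra! hpos
  obtain ⟨ε, hε, hvε⟩ : ∃ ε > 0, ∀ x, ε ≤ v x := by
    rcases isEmpty_or_nonempty X with h | h
    · exact ⟨1, one_pos, fun x => h.elim x⟩
    · obtain ⟨x₀, hx₀⟩ := Finite.exists_min v
      exact ⟨v x₀, hpos x₀, hx₀⟩
  exact hR.not_ge (mul_randComplexityOfFun_le hβ hd hε hv hvε hB hγ)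

theorem exists_stdSimplex_forall_forecastPayoff_nonpos [Fintype X] {f : X → Bool} {β B γ : ℝ}
    (hβ : 0 < β) (hB : 0 ≤ B) (hγ : Real.exp (-B / 64) ≤ 1 - γ)
    (hR : 2 * (B + 3) < β * randComplexityOfFun f γ) :
    ∃ μ ∈ stdSimplex ℝ X, ∀ D : ForecastTree ι, ∑ x, μ x * forecastPayoff β D x (f x) ≤ 0 := by
  have hd : β / 2 * ⌊2 / β⌋₊ ≤ 1 := by
    have := Nat.floor_le (show 0 ≤ 2 / β by positivity)
    rw [le_div_iff₀ hβ] at this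
    linarith
  have hd' : 2 ≤ β * (⌊2 / β⌋₊ + 1) := by
    rw [← div_le_iff₀' hβ]
    exact (Nat.lt_floor_add_one _).le
  obtain ⟨μ, hμ, hμv⟩ := exists_mem_stdSimplex_forall_dotProduct_nonpos
    (K := mixedScores (payoffVector (β / 2) f) ⌊2 / β⌋₊) (convex_convexHull ℝ _)
    ⟨_, score_mem_mixedScores _ (D := .leaf zeroForecast) (Nat.zero_le _)⟩
    fun v => exists_payoffVector_nonpos (half_pos hβ) hd hB hγ (by linarith)
  refine ⟨μ, hμ, fun D => le_trans (Finset.sum_le_sum fun x _ => ?_)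
    (hμv _ (score_mem_mixedScores _ (D.depth_truncate_le zeroForecast _)))⟩
  exact mul_le_mul_of_nonneg_left (forecastPayoff_le_truncate hd' D x (f x)) (hμ.1 x)

end HardDistribution

section Potential

variable {ι : Type}

/-- The part of the weight `w` that lives on the inputs whose bit `i` is `b`. -/
noncomputable def restrictWeight (w : (ι → Bool) → ℝ) (i : ι) (b : Bool) : (ι → Bool) → ℝ :=
  {x | x i = b}.indicator w

theorem restrictWeight_nonneg {w : (ι → Bool) → ℝ} (hw : 0 ≤ w) (i : ι) (b : Bool) :
    0 ≤ restrictWeight w i b :=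
  Set.indicator_nonneg fun x _ => hw x

variable [Fintype ι] [DecidableEq ι]

theorem sum_restrictWeight_mul_add (w g₀ g₁ : (ι → Bool) → ℝ) (i : ι) :
    ∑ x, restrictWeight w i false x * g₀ x + ∑ x, restrictWeight w i true x * g₁ x =
      ∑ x, w x * if x i then g₁ x else g₀ x := by
  rw [← Finset.sum_add_distrib]
  refine Finset.sum_congr rfl fun x _ => ?_
  cases hx : x i <;> simp [restrictWeight, hx]

theorem sum_restrictWeight_add (w : (ι → Bool) → ℝ) (i : ι) :
    ∑ x, restrictWeight w i false x + ∑ x, restrictWeight w i true x = ∑ x, w x := by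
  simpa using sum_restrictWeight_mul_add w 1 1 i

/-- The mass of the inputs with label `b`. -/
noncomputable def labelMass (F : (ι → Bool) → Bool) (w : (ι → Bool) → ℝ) (b : Bool) : ℝ :=
  ∑ x with F x = b, w x

/-- The largest total payoff of a forecasting tree against the weight `w`. -/
noncomputable def maxPayoff (β : ℝ) (F : (ι → Bool) → Bool) (w : (ι → Bool) → ℝ) : ℝ :=
  ⨆ D : ForecastTree ι, ∑ x, w x * forecastPayoff β D x (F x)

/-- The total mass of a weight plus the largest payoff against it. It equals the mass when no
forecasting tree profits, and a leaf that separates the labels doubles it. -/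
noncomputable def potential (β : ℝ) (F : (ι → Bool) → Bool) (w : (ι → Bool) → ℝ) : ℝ :=
  ∑ x, w x + maxPayoff β F w

variable {β : ℝ} {F : (ι → Bool) → Bool} {w : (ι → Bool) → ℝ}

theorem le_maxPayoff (hβ : 0 ≤ β) (hw : 0 ≤ w) (D : ForecastTree ι) :
    ∑ x, w x * forecastPayoff β D x (F x) ≤ maxPayoff β F w := by
  refine le_ciSup (f := fun D => ∑ x, w x * forecastPayoff β D x (F x)) ⟨∑ x, w x, ?_⟩ D
  rintro _ ⟨D, rfl⟩
  exact Finset.sum_le_sum fun x _ => mul_le_of_le_one_right (hw x) (forecastPayoff_le hβ D x (F x))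

theorem maxPayoff_nonneg (hβ : 0 ≤ β) (hw : 0 ≤ w) : 0 ≤ maxPayoff β F w := by
  refine le_trans (le_of_eq ?_) (le_maxPayoff hβ hw (.leaf zeroForecast))
  simp [forecastPayoff, DecisionTree.eval, DecisionTree.cost, zeroForecast]

theorem potential_nonneg (hβ : 0 ≤ β) (hw : 0 ≤ w) : 0 ≤ potential β F w :=
  add_nonneg (Finset.sum_nonneg fun x _ => hw x) (maxPayoff_nonneg hβ hw)

theorem maxPayoff_restrictWeight_add_le (hβ : 0 ≤ β) (hw : 0 ≤ w) (i : ι) :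
    maxPayoff β F (restrictWeight w i false) + maxPayoff β F (restrictWeight w i true) ≤
      maxPayoff β F w + β * ∑ x, w x := by
  have : Nonempty (ForecastTree ι) := ⟨.leaf zeroForecast⟩
  refine ciSup_add_ciSup_le fun D₀ D₁ => ?_
  have hquery : ∑ x, restrictWeight w i false x * forecastPayoff β D₀ x (F x) +
      ∑ x, restrictWeight w i true x * forecastPayoff β D₁ x (F x) =
        ∑ x, w x * forecastPayoff β (.query i D₀ D₁) x (F x) + β * ∑ x, w x := by
    rw [sum_restrictWeight_mul_add, Finset.mul_sum, ← Finset.sum_add_distrib]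
    refine Finset.sum_congr rfl fun x _ => ?_
    cases hx : x i <;>
      simp [forecastPayoff, DecisionTree.eval, DecisionTree.cost, hx] <;> ring
  rw [hquery]
  gcongr
  exact le_maxPayoff hβ hw _

theorem potential_restrictWeight_add_le (hβ : 0 ≤ β) (hw : 0 ≤ w) (i : ι) :
    potential β F (restrictWeight w i false) + potential β F (restrictWeight w i true) ≤
      (1 + β) * potential β F w := by
  have hpayoff := maxPayoff_restrictWeight_add_le (F := F) hβ hw i
  have hmass := sum_restrictWeight_add w i
  have hnonneg := mul_nonneg hβ (maxPayoff_nonneg (F := F) hβ hw)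
  unfold potential
  linarith

theorem sum_eq_labelMass_add (F : (ι → Bool) → Bool) (w : (ι → Bool) → ℝ) :
    ∑ x, w x = labelMass F w true + labelMass F w false := by
  simp only [labelMass]
  rw [← Fintype.sum_bool fun b => ∑ x with F x = b, w x, Finset.sum_fiberwise]

theorem sum_mul_boolSign (F : (ι → Bool) → Bool) (w : (ι → Bool) → ℝ) :
    ∑ x, w x * boolSign (F x) = labelMass F w true - labelMass F w false := by
  simp only [labelMass, Finset.sum_filter, ← Finset.sum_sub_distrib]
  exact Finset.sum_congr rfl fun x _ => by cases hx : F x <;> simp [boolSign]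

theorem sum_mul_forecastPayoff_leaf (β : ℝ) (F : (ι → Bool) → Bool) (w : (ι → Bool) → ℝ)
    (a : Set.Icc (-1 : ℝ) 1) :
    ∑ x, w x * forecastPayoff β (.leaf a) x (F x) =
      2 * a.1 * ∑ x, w x * boolSign (F x) - a.1 ^ 2 * ∑ x, w x := by
  rw [Finset.mul_sum, Finset.mul_sum, ← Finset.sum_sub_distrib]
  refine Finset.sum_congr rfl fun x _ => ?_
  simp only [forecastPayoff, DecisionTree.eval, DecisionTree.cost, Nat.cast_zero]
  ring

theorem labelMass_nonneg (F : (ι → Bool) → Bool) (hw : 0 ≤ w) (b : Bool) : 0 ≤ labelMass F w b :=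
  Finset.sum_nonneg fun x _ => hw x

theorem sq_sum_mul_boolSign_le (hβ : 0 ≤ β) (hw : 0 ≤ w) :
    (∑ x, w x * boolSign (F x)) ^ 2 ≤ (∑ x, w x) * maxPayoff β F w := by
  have hfalse := labelMass_nonneg F hw false
  have htrue := labelMass_nonneg F hw true
  have habs : |∑ x, w x * boolSign (F x)| ≤ ∑ x, w x := by
    rw [sum_mul_boolSign, sum_eq_labelMass_add F, abs_le]
    constructor <;> linarith
  have hleaf := fun a => (sum_mul_forecastPayoff_leaf β F w a).symm.trans_le
    (le_maxPayoff hβ hw (.leaf a))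
  generalize ∑ x, w x * boolSign (F x) = s at *
  generalize ∑ x, w x = M at *
  rcases (abs_nonneg s).trans habs |>.eq_or_lt with rfl | hM
  · simp [abs_nonpos_iff.mp habs]
  · have ha : |s / M| ≤ 1 := by rwa [abs_div, abs_of_pos hM, div_le_one hM]
    calc s ^ 2 = M * (2 * (s / M) * s - (s / M) ^ 2 * M) := by field_simp; ring
      _ ≤ M * maxPayoff β F w := mul_le_mul_of_nonneg_left (hleaf ⟨s / M, abs_le.mp ha⟩) hM.le

theorem sum_labelMass_sq_le (hβ : 0 ≤ β) (hw : 0 ≤ w) :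
    ∑ b, labelMass F w b ^ 2 ≤ potential β F w * (∑ x, w x) / 2 := by
  have h := sq_sum_mul_boolSign_le (F := F) hβ hw
  rw [sum_mul_boolSign, sum_eq_labelMass_add F] at h
  rw [Fintype.sum_bool, potential, sum_eq_labelMass_add F]
  linarith

end Potential

section ListDecoding

variable {κ ι : Type}

theorem update_restrictWeight_nonneg [DecidableEq κ] {w : κ → (ι → Bool) → ℝ} (hw : ∀ k, 0 ≤ w k)
    (k : κ) (i : ι) (b : Bool) (l : κ) :
    0 ≤ Function.update w k (restrictWeight (w k) i b) l :=
  (Function.forall_update_iff w fun _ u => 0 ≤ u).mpr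
    ⟨restrictWeight_nonneg (hw k) i b, fun l _ => hw l⟩ l

variable [Fintype κ]

/-- The weight of a tuple of inputs under the product of the weights `w k`. -/
def prodWeight (w : κ → (ι → Bool) → ℝ) (x : κ × ι → Bool) : ℝ :=
  ∏ k, w k fun j => x (k, j)

theorem prodWeight_nonneg {w : κ → (ι → Bool) → ℝ} (hw : ∀ k, 0 ≤ w k) (x : κ × ι → Bool) :
    0 ≤ prodWeight w x :=
  Finset.prod_nonneg fun k _ => hw k _

/-- The tuple of the labels of the blocks of `x`. -/
def blockMap (F : (ι → Bool) → Bool) (x : κ × ι → Bool) : κ → Bool :=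
  fun k => F fun j => x (k, j)

theorem prodWeight_update_restrictWeight [DecidableEq κ] (w : κ → (ι → Bool) → ℝ) (k : κ) (i : ι)
    (b : Bool) :
    prodWeight (Function.update w k (restrictWeight (w k) i b)) =
      restrictWeight (prodWeight w) (k, i) b := by
  ext x
  by_cases h : x (k, i) = b
  · have hkeep : restrictWeight (prodWeight w) (k, i) b x = prodWeight w x := by
      simp [restrictWeight, h]
    rw [hkeep]
    refine Finset.prod_congr rfl fun l _ => ?_
    rcases eq_or_ne l k with rfl | hl
    · simp [restrictWeight, h]
    · simp [hl]
  · have hdrop : restrictWeight (prodWeight w) (k, i) b x = 0 := by simp [restrictWeight, h]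
    rw [hdrop]
    exact Finset.prod_eq_zero (Finset.mem_univ k) (by simp [restrictWeight, h])

theorem prod_update_add_prod_update_le {α : Type*} [DecidableEq κ] {φ : α → ℝ} {w : κ → α} {k : κ}
    {u₀ u₁ : α} {c : ℝ} (hφ : ∀ l, 0 ≤ φ (w l)) (hk : φ u₀ + φ u₁ ≤ c * φ (w k)) :
    ∏ l, φ (Function.update w k u₀ l) + ∏ l, φ (Function.update w k u₁ l) ≤ c * ∏ l, φ (w l) := by
  have hupdate : ∀ u, ∏ l, φ (Function.update w k u l) =
      φ u * ∏ l ∈ Finset.univ.erase k, φ (w l) := by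
    intro u
    rw [← Finset.mul_prod_erase _ _ (Finset.mem_univ k), Function.update_self]
    congr 1
    exact Finset.prod_congr rfl fun l hl => by
      rw [Function.update_of_ne (Finset.ne_of_mem_erase hl)]
  rw [hupdate, hupdate, ← add_mul, ← Finset.mul_prod_erase _ _ (Finset.mem_univ k), ← mul_assoc]
  exact mul_le_mul_of_nonneg_right hk (Finset.prod_nonneg fun l _ => hφ l)

variable [Fintype ι] [DecidableEq ι]

/-- The geometric mean of the product of the potentials and the product of the masses of the
weights. It controls the success weight of a tree that reads all blocks, and is a mean because the
Cauchy–Schwarz inequality at a leaf bounds only the square of the success weight. -/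
noncomputable def jointPotential (β : ℝ) (F : (ι → Bool) → Bool) (w : κ → (ι → Bool) → ℝ) : ℝ :=
  √((∏ k, potential β F (w k)) * ∏ k, ∑ x, w k x)

theorem jointPotential_const_le_one {β : ℝ} {F : (ι → Bool) → Bool} (hβ : 0 ≤ β)
    {μ : (ι → Bool) → ℝ} (hμ : 0 ≤ μ) (hμ1 : ∑ x, μ x = 1)
    (hpay : ∀ D : ForecastTree ι, ∑ x, μ x * forecastPayoff β D x (F x) ≤ 0) :
    jointPotential β F (fun _ : κ => μ) ≤ 1 := by
  have : Nonempty (ForecastTree ι) := ⟨.leaf zeroForecast⟩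
  have hpot : potential β F μ ≤ 1 := by
    rw [potential, hμ1]
    linarith [show maxPayoff β F μ ≤ 0 from ciSup_le hpay]
  rw [jointPotential, hμ1, Finset.prod_const_one, mul_one, Real.sqrt_le_one]
  exact Finset.prod_le_one (fun _ _ => potential_nonneg hβ hμ) fun _ _ => hpot

variable [DecidableEq κ]

theorem sum_prodWeight_mul_prod (w g : κ → (ι → Bool) → ℝ) :
    ∑ x : κ × ι → Bool, prodWeight w x * ∏ k, g k (fun j => x (k, j)) =
      ∏ k, ∑ x, w k x * g k x := by
  rw [Finset.prod_univ_sum, Fintype.piFinset_univ]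
  refine Fintype.sum_equiv (Equiv.curry κ ι Bool) _ _ fun x => ?_
  rw [prodWeight, ← Finset.prod_mul_distrib]
  rfl

theorem sum_prodWeight_mul_blockMap (F : (ι → Bool) → Bool) (w : κ → (ι → Bool) → ℝ)
    (g : (κ → Bool) → ℝ) :
    ∑ x, prodWeight w x * g (blockMap F x) = ∑ v, (∏ k, labelMass F (w k) (v k)) * g v := by
  have hmass : ∀ v : κ → Bool, ∏ k, labelMass F (w k) (v k) =
      ∑ x, prodWeight w x * if blockMap F x = v then 1 else 0 := by
    intro v
    have hboole : ∀ k, labelMass F (w k) (v k) = ∑ x, w k x * if F x = v k then 1 else 0 :=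
      fun k => by simp [labelMass, Finset.sum_filter]
    simp only [hboole]
    rw [← sum_prodWeight_mul_prod w fun k x => if F x = v k then 1 else 0]
    refine Finset.sum_congr rfl fun x _ => ?_
    rw [Finset.prod_ite_zero, Finset.prod_const_one]
    simp [funext_iff, blockMap]
  simp only [hmass, Finset.sum_mul]
  rw [Finset.sum_comm]
  refine Finset.sum_congr rfl fun x _ => by simp

/-- The weight of the inputs on which `D` gives an answer accepted by `rel`, each discounted by `δ`
for every query made. -/
noncomputable def discountedSuccess {O : Type} (δ : ℝ) (F : (ι → Bool) → Bool)
    (rel : (κ → Bool) → Set O) (w : κ → (ι → Bool) → ℝ) (D : DecisionTree (κ × ι) O) : ℝ :=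
  ∑ x, prodWeight w x * (δ ^ D.cost x * (rel (blockMap F x)).indicator 1 (D.eval x))

variable {O : Type} {F : (ι → Bool) → Bool} {rel : (κ → Bool) → Set O} {w : κ → (ι → Bool) → ℝ}

theorem discountedSuccess_query (δ : ℝ) (k : κ) (i : ι) (D₀ D₁ : DecisionTree (κ × ι) O) :
    discountedSuccess δ F rel w (.query (k, i) D₀ D₁) =
      δ * (discountedSuccess δ F rel (Function.update w k (restrictWeight (w k) i false)) D₀ +
        discountedSuccess δ F rel (Function.update w k (restrictWeight (w k) i true)) D₁) := by
  simp only [discountedSuccess, prodWeight_update_restrictWeight]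
  rw [sum_restrictWeight_mul_add, Finset.mul_sum]
  refine Finset.sum_congr rfl fun x _ => ?_
  cases hx : x (k, i) <;> simp [DecisionTree.eval, DecisionTree.cost, hx, pow_succ] <;> ring

theorem sqrt_mul_add_sqrt_mul_le {a₀ a₁ b₀ b₁ : ℝ} (ha₀ : 0 ≤ a₀) (ha₁ : 0 ≤ a₁) (hb₀ : 0 ≤ b₀)
    (hb₁ : 0 ≤ b₁) : √(a₀ * b₀) + √(a₁ * b₁) ≤ √((a₀ + a₁) * (b₀ + b₁)) := by
  have h := Real.sum_sqrt_mul_sqrt_le Finset.univ (f := fun b : Bool => if b then a₁ else a₀)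
    (g := fun b => if b then b₁ else b₀) (by rintro (_ | _) <;> simpa)
    (by rintro (_ | _) <;> simpa)
  simp only [Fintype.sum_bool, if_true, Bool.false_eq_true, if_false] at h
  rw [Real.sqrt_mul ha₀, Real.sqrt_mul ha₁, Real.sqrt_mul (by positivity)]
  linarith [add_comm a₁ a₀ ▸ add_comm b₁ b₀ ▸ h]

theorem jointPotential_update_add_le {β : ℝ} (hβ : 0 ≤ β) (hw : ∀ k, 0 ≤ w k) (k : κ) (i : ι) :
    jointPotential β F (Function.update w k (restrictWeight (w k) i false)) +
        jointPotential β F (Function.update w k (restrictWeight (w k) i true)) ≤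
      √(1 + β) * jointPotential β F w := by
  have hrestr := update_restrictWeight_nonneg hw k i
  have hpot := fun b => Finset.prod_nonneg fun l (_ : l ∈ Finset.univ) =>
    potential_nonneg (F := F) hβ (hrestr b l)
  have hmass := fun b => Finset.prod_nonneg fun l (_ : l ∈ Finset.univ) =>
    Finset.sum_nonneg fun x (_ : x ∈ Finset.univ) => hrestr b l x
  have hpot_add := prod_update_add_prod_update_le (fun l => potential_nonneg hβ (hw l))
    (potential_restrictWeight_add_le (F := F) hβ (hw k) i)
  have hmass_add := prod_update_add_prod_update_le (φ := fun u : (ι → Bool) → ℝ => ∑ x, u x)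
    (c := 1) (fun l => Finset.sum_nonneg fun x _ => hw l x)
    ((sum_restrictWeight_add (w k) i).trans_le (one_mul _).ge)
  rw [one_mul] at hmass_add
  rw [jointPotential, jointPotential, jointPotential, ← Real.sqrt_mul (by linarith), ← mul_assoc]
  refine (sqrt_mul_add_sqrt_mul_le (hpot _) (hpot _) (hmass _) (hmass _)).trans
    (Real.sqrt_le_sqrt ?_)
  exact mul_le_mul hpot_add hmass_add (add_nonneg (hmass _) (hmass _))
    ((add_nonneg (hpot _) (hpot _)).trans hpot_add)

theorem discountedSuccess_leaf_le {β : ℝ} (hβ : 0 ≤ β) (hw : ∀ k, 0 ≤ w k) (δ : ℝ) (o : O) {N : ℕ}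
    (hN : {v | o ∈ rel v}.ncard ≤ N) :
    discountedSuccess δ F rel w (.leaf o) ≤
      √(N / 2 ^ Fintype.card κ) * jointPotential β F w := by
  classical
  have hleaf : discountedSuccess δ F rel w (.leaf o) =
      ∑ v with o ∈ rel v, ∏ k, labelMass F (w k) (v k) := by
    simp only [discountedSuccess, DecisionTree.cost, DecisionTree.eval, pow_zero, one_mul]
    rw [sum_prodWeight_mul_blockMap F w fun v => (rel v).indicator 1 o, Finset.sum_filter]
    exact Finset.sum_congr rfl fun v _ => by simp [Set.indicator_apply]
  have hcard : ((Finset.univ.filter fun v => o ∈ rel v).card : ℝ) ≤ N := by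
    rw [Set.ncard_eq_toFinset_card'] at hN
    exact_mod_cast (by simpa using hN)
  rw [hleaf, jointPotential, ← Real.sqrt_mul (by positivity)]
  refine Real.le_sqrt_of_sq_le ?_
  calc (∑ v with o ∈ rel v, ∏ k, labelMass F (w k) (v k)) ^ 2
      ≤ (Finset.univ.filter fun v => o ∈ rel v).card *
          ∑ v with o ∈ rel v, (∏ k, labelMass F (w k) (v k)) ^ 2 := sq_sum_le_card_mul_sum_sq
    _ ≤ N * ∑ v : κ → Bool, (∏ k, labelMass F (w k) (v k)) ^ 2 := by
        gcongr
        exact Finset.filter_subset _ _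
    _ = N * ∏ k, ∑ b, labelMass F (w k) b ^ 2 := by
        simp only [← Finset.prod_pow, Finset.prod_univ_sum, Fintype.piFinset_univ]
    _ ≤ N * ∏ k, (potential β F (w k) * (∑ x, w k x) / 2) := by
        gcongr with k
        exact sum_labelMass_sq_le hβ (hw k)
    _ = _ := by
        rw [Finset.prod_div_distrib, Finset.prod_mul_distrib, Finset.prod_const, Finset.card_univ]
        ring

theorem discountedSuccess_le {β : ℝ} (hβ : 0 ≤ β) {N : ℕ} (hN : ∀ o, {v | o ∈ rel v}.ncard ≤ N)
    (D : DecisionTree (κ × ι) O) (hw : ∀ k, 0 ≤ w k) :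
    discountedSuccess (√(1 + β))⁻¹ F rel w D ≤
      √(N / 2 ^ Fintype.card κ) * jointPotential β F w := by
  induction D generalizing w with
  | leaf o => exact discountedSuccess_leaf_le hβ hw _ o (hN o)
  | query p D₀ D₁ ih₀ ih₁ =>
    obtain ⟨k, i⟩ := p
    rw [discountedSuccess_query, inv_mul_le_iff₀ (Real.sqrt_pos.mpr (by linarith))]
    refine (add_le_add (ih₀ (update_restrictWeight_nonneg hw k i false))
      (ih₁ (update_restrictWeight_nonneg hw k i true))).trans ?_
    rw [← mul_add, mul_left_comm]
    exact mul_le_mul_of_nonneg_left (jointPotential_update_add_le hβ hw k i) (Real.sqrt_nonneg _)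

theorem sum_prodWeight_mul_indicator_le {β : ℝ} (hβ : 0 ≤ β) {μ : (ι → Bool) → ℝ} (hμ : 0 ≤ μ)
    (hμ1 : ∑ x, μ x = 1) (hpay : ∀ D : ForecastTree ι, ∑ x, μ x * forecastPayoff β D x (F x) ≤ 0)
    {N : ℕ} (hN : ∀ o, {v | o ∈ rel v}.ncard ≤ N) {q : ℕ} {D : DecisionTree (κ × ι) O}
    (hq : ∀ x, prodWeight (fun _ => μ) x ≠ 0 → D.cost x ≤ q) :
    ∑ x, prodWeight (fun _ => μ) x * (rel (blockMap F x)).indicator 1 (D.eval x) ≤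
      √(1 + β) ^ q * √(N / 2 ^ Fintype.card κ) := by
  have hδ : 0 < √(1 + β) := Real.sqrt_pos.mpr (by linarith)
  have hdiscount : (√(1 + β))⁻¹ ^ q *
      ∑ x, prodWeight (fun _ => μ) x * (rel (blockMap F x)).indicator 1 (D.eval x) ≤
        discountedSuccess (√(1 + β))⁻¹ F rel (fun _ => μ) D := by
    rw [discountedSuccess, Finset.mul_sum]
    refine Finset.sum_le_sum fun x _ => ?_
    rcases (prodWeight_nonneg (fun _ => hμ) x).eq_or_lt' with hx | hx
    · simp [hx]
    rw [mul_left_comm]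
    refine mul_le_mul_of_nonneg_left (mul_le_mul_of_nonneg_right ?_ ?_) hx.le
    · exact pow_le_pow_of_le_one (by positivity)
        (inv_le_one_of_one_le₀ (Real.one_le_sqrt.mpr (by linarith))) (hq x hx.ne')
    · exact Set.indicator_nonneg (fun _ _ => zero_le_one) _
  have hbound := hdiscount.trans ((discountedSuccess_le hβ hN D fun _ => hμ).trans
    (mul_le_of_le_one_right (Real.sqrt_nonneg _) (jointPotential_const_le_one hβ hμ hμ1 hpay)))
  rwa [inv_pow, inv_mul_le_iff₀ (pow_pos hδ q)] at hbound

end ListDecoding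

section DirectProduct

open MeasureTheory in
theorem exists_mem_support_sum_successProb_le {ι O : Type} [Fintype ι] [DecidableEq ι]
    (R : RandomizedAlgorithm ι O) (w : (ι → Bool) → ℝ) (S : (ι → Bool) → Set O) :
    ∃ D ∈ R.support, ∑ x, w x * R.successProb x (S x) ≤
      ∑ x, w x * (S x).indicator 1 (D.eval x) := by
  let _ : MeasurableSpace (DecisionTree ι O) := ⊤
  have hmeas : ∀ E : Set (DecisionTree ι O), MeasurableSet E := fun _ => trivial
  have hprob : ∀ x, ∫ D, (S x).indicator (1 : O → ℝ) (D.eval x) ∂(R.toMeasure) =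
      R.successProb x (S x) := fun x => by
    rw [RandomizedAlgorithm.successProb, ← R.toMeasure_apply_eq_toOuterMeasure_apply (hmeas _)]
    exact integral_indicator_one (hmeas {D | D.eval x ∈ S x})
  have hint : ∀ x, Integrable (fun D : DecisionTree ι O =>
      w x * (S x).indicator (1 : O → ℝ) (D.eval x)) R.toMeasure := fun x =>
    ((integrable_const (1 : ℝ)).indicator (hmeas {D | D.eval x ∈ S x})).const_mul _
  obtain ⟨D, hD, hle⟩ := exists_notMem_null_integral_le
    (integrable_finsetSum Finset.univ fun x _ => hint x)
    ((R.toMeasure_apply_eq_zero_iff (hmeas R.supportᶜ)).mpr disjoint_compl_right)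
  rw [integral_finsetSum _ fun x _ => hint x] at hle
  exact ⟨D, not_not.mp hD, by simpa only [integral_const_mul, hprob] using hle⟩

theorem exists_weight_forall_forecastPayoff_nonpos {ι : Type} [Fintype ι] [DecidableEq ι]
    {X : Set (ι → Bool)} {f : X → Bool} {β B γ : ℝ} (hβ : 0 < β) (hB : 0 ≤ B)
    (hγ : Real.exp (-B / 64) ≤ 1 - γ) (hR : 2 * (B + 3) < β * randComplexityOfFun f γ) :
    ∃ (F : (ι → Bool) → Bool) (μ : (ι → Bool) → ℝ), X.domRestrict F = f ∧ 0 ≤ μ ∧ ∑ x, μ x = 1 ∧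
      Function.support μ ⊆ X ∧
        ∀ D : ForecastTree ι, ∑ x, μ x * forecastPayoff β D x (F x) ≤ 0 := by
  classical
  obtain ⟨μ, hμ, hpay⟩ := exists_stdSimplex_forall_forecastPayoff_nonpos hβ hB hγ hR
  have hsum : ∀ g : (ι → Bool) → ℝ,
      ∑ x, Function.extend Subtype.val μ 0 x * g x = ∑ x : X, μ x * g x := by
    intro g
    refine (Fintype.sum_of_injective _ Subtype.val_injective _ _ (fun x hx => ?_) fun x => ?_).symm
    · simp [Function.extend_apply' _ _ _ hx]
    · rw [Subtype.val_injective.extend_apply]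
  refine ⟨Function.extend Subtype.val f fun _ => false, Function.extend Subtype.val μ 0,
    funext fun x => Subtype.val_injective.extend_apply f _ x, fun x => ?_, ?_, fun x hx => ?_,
    fun D => ?_⟩
  · by_cases hx : x ∈ X
    · simpa [hx] using (Subtype.val_injective.extend_apply μ 0 ⟨x, hx⟩).symm ▸ hμ.1 ⟨x, hx⟩
    · simp [Function.extend_apply', hx]
  · simpa [hμ.2] using hsum 1
  · by_contra hxX
    exact hx (Function.extend_apply' _ _ _ (by simpa using hxX))
  · rw [hsum]
    simpa only [Subtype.val_injective.extend_apply] using hpay D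

theorem computes_comp_productFun_le_sqrt {m n : ℕ} {X : Set (Fin m → Bool)} {f : X → Bool}
    {β B γ : ℝ} (hβ : 0 < β) (hB : 0 ≤ B) (hγ : Real.exp (-B / 64) ≤ 1 - γ)
    (hR : 2 * (B + 3) < β * randComplexityOfFun f γ) {O : Type} {rel : (Fin n → Bool) → Set O}
    {N : ℕ} (hN : ∀ o, {v | o ∈ rel v}.ncard ≤ N) {R : RandomizedAlgorithm (Fin n × Fin m) O}
    {σ : ℝ} (hσ : R.Computes (fun x => rel (productFun f n x)) σ) {q : ℕ}
    (hq : R.cost (productDomain X n) ≤ q) : σ ≤ √(1 + β) ^ q * √(N / 2 ^ n) := by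
  obtain ⟨F, μ, rfl, hμ, hμ1, hμX, hpay⟩ := exists_weight_forall_forecastPayoff_nonpos hβ hB hγ hR
  have hdomain : ∀ x, prodWeight (fun _ : Fin n => μ) x ≠ 0 → x ∈ productDomain X n := fun x hx i =>
    hμX (Finset.prod_ne_zero_iff.mp hx i (Finset.mem_univ i))
  have hmass : ∑ x, prodWeight (fun _ : Fin n => μ) x = 1 := by
    simpa [hμ1] using sum_prodWeight_mul_prod (fun _ : Fin n => μ) 1
  obtain ⟨D, hD, hle⟩ := exists_mem_support_sum_successProb_le R (prodWeight fun _ : Fin n => μ)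
    fun x => rel (blockMap F x)
  have hcost : ∀ x, prodWeight (fun _ : Fin n => μ) x ≠ 0 → D.cost x ≤ q := fun x hx => by
    exact_mod_cast (le_iSup₂_of_le x (hdomain x hx) (le_iSup₂_of_le D hD le_rfl)).trans hq
  calc σ = ∑ x, prodWeight (fun _ : Fin n => μ) x * σ := by rw [← Finset.sum_mul, hmass, one_mul]
    _ ≤ ∑ x, prodWeight (fun _ : Fin n => μ) x * R.successProb x (rel (blockMap F x)) := by
        refine Finset.sum_le_sum fun x _ => ?_
        rcases (prodWeight_nonneg (fun _ : Fin n => hμ) x).eq_or_lt' with hx | hx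
        · simp [hx]
        · exact mul_le_mul_of_nonneg_left (hσ ⟨x, hdomain x hx.ne'⟩) hx.le
    _ ≤ _ := hle
    _ ≤ √(1 + β) ^ q * √(N / 2 ^ n) := by
        simpa using sum_prodWeight_mul_indicator_le hβ.le hμ hμ1 hpay hN hcost

end DirectProduct

section Threshold

theorem card_hammingDist_eq {κ : Type*} [Fintype κ] [DecidableEq κ] (z : κ → Bool) (j : ℕ) :
    Finset.card {y : κ → Bool | hammingDist y z = j} = (Fintype.card κ).choose j := by
  rw [← Finset.card_univ, ← Finset.card_powersetCard]
  refine Finset.card_bij' (fun y _ => Finset.univ.filter fun i => y i ≠ z i)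
    (fun s _ i => if i ∈ s then !z i else z i) ?_ ?_ ?_ ?_
  · intro y hy
    simpa [Finset.mem_powersetCard, hammingDist] using hy
  · intro s hs
    simpa [Finset.mem_powersetCard, hammingDist] using hs
  · intro y _
    ext i
    cases hy : y i <;> cases hz : z i <;> simp [hy, hz]
  · intro s _
    ext i
    by_cases hi : i ∈ s <;> simp [hi]

theorem ncard_setOf_mem_Thr {n k : ℕ} (hk : k ≤ n) (z : Fin n → Bool) :
    {y | z ∈ Thr n k y}.ncard = ∑ j ∈ Finset.range (n - k + 1), n.choose j := by
  have hagree : ∀ y : Fin n → Bool,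
      (Finset.univ.filter fun i => y i = z i).card + hammingDist y z = n := fun y => by
    rw [hammingDist, Finset.card_filter_add_card_filter_not, Finset.card_univ, Fintype.card_fin]
  have hball : {y | z ∈ Thr n k y} =
      ({y | hammingDist y z ∈ Finset.range (n - k + 1)} : Finset (Fin n → Bool)) := by
    ext y
    have := hagree y
    simp only [Thr, Set.mem_ofPred_eq, Finset.coe_filter, Finset.mem_univ, true_and,
      Finset.mem_range]
    omega
  rw [hball, Set.ncard_coe_finset, ← Finset.sum_card_fiberwise_eq_card_filter]
  simp only [card_hammingDist_eq, Fintype.card_fin]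

theorem sum_choose_div_two_pow_eq_two_rpow_neg_tau (n k : ℕ) :
    (∑ i ∈ Finset.range (n - k + 1), (n.choose i : ℝ)) / 2 ^ n = 2 ^ (-tau n k) := by
  have hpos : (0 : ℝ) < ∑ i ∈ Finset.range (n - k + 1), (n.choose i : ℝ) :=
    Finset.sum_pos' (fun i _ => Nat.cast_nonneg _) ⟨0, by simp, by simp⟩
  rw [tau, ← Real.logb_inv, inv_div, Real.rpow_logb two_pos (by norm_num) (by positivity)]

theorem tau_nonneg (n k : ℕ) : 0 ≤ tau n k := by
  have hsum : ∑ i ∈ Finset.range (n - k + 1), n.choose i ≤ 2 ^ n := by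
    rw [← Nat.sum_range_choose]
    exact Finset.sum_le_sum_of_subset (Finset.range_mono (by omega))
  refine Real.logb_nonneg one_lt_two ?_
  rw [one_le_div (Finset.sum_pos' (fun i _ => Nat.cast_nonneg _) ⟨0, by simp, by simp⟩)]
  exact_mod_cast hsum

theorem log_le_of_le_sqrt_pow_mul_sqrt {σ β θ : ℝ} {q : ℕ} (hσ : 0 < σ) (hβ : 0 ≤ β) (hθ : 0 < θ)
    (h : σ ≤ √(1 + β) ^ q * √θ) : Real.log σ ≤ (q * β + Real.log θ) / 2 := by
  have hlog := Real.log_le_log hσ h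
  rw [Real.log_mul (by positivity) (by positivity), Real.log_pow, Real.log_sqrt (by linarith),
    Real.log_sqrt hθ.le] at hlog
  have hβ_log : Real.log (1 + β) ≤ β := by
    linarith [Real.log_le_sub_one_of_pos (by linarith : 0 < 1 + β)]
  linarith [mul_le_mul_of_nonneg_left hβ_log q.cast_nonneg]

end Threshold

theorem mainTheorem6_general {m : ℕ} {X : Set (Fin m → Bool)} (f : X → Bool) {n k : ℕ}
    (hk : k ≤ n) {γ : ℝ} (hγ : 0 < γ) (hγ1 : γ ≤ 1) :
    2 * Real.log (√2 * γ) / 263 * (tau n k * (randComplexityOfFun f (2 / 3) : ℝ)) ≤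
      (randQueryComplexity (fun x => Thr n k (productFun f n x)) (γ ^ tau n k) : ℝ) := by
  set q := randQueryComplexity (fun x => Thr n k (productFun f n x)) (γ ^ tau n k)
  rcases (randComplexityOfFun f (2 / 3)).eq_zero_or_pos with hr | hr
  · simp [hr]
  have hr_pos : (0 : ℝ) < randComplexityOfFun f (2 / 3) := by exact_mod_cast hr
  obtain ⟨R, hR, hq⟩ := randQueryComplexity_attained (fun x => Thr n k (productFun f n x))
    (fun x => ⟨productFun f n x, by simpa [Thr] using hk⟩)
    (Real.rpow_le_one hγ.le hγ1 (tau_nonneg n k))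
  have hexp : Real.exp (-128 / 64) ≤ 1 - 2 / 3 := by
    rw [show (-128 / 64 : ℝ) = -2 by norm_num, Real.exp_neg]
    exact (inv_anti₀ (by norm_num) (Real.add_one_le_exp 2)).trans (by norm_num)
  -- `263` exceeds `2 * (128 + 3)`, and `128` makes the error `exp (-128 / 64)` at most `1 / 3`.
  have hsucc := computes_comp_productFun_le_sqrt (div_pos (by norm_num : (0 : ℝ) < 263) hr_pos)
    (by norm_num) hexp (by rw [div_mul_cancel₀ _ hr_pos.ne']; norm_num)
    (fun z => (ncard_setOf_mem_Thr hk z).le) hR hq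
  push_cast at hsucc
  rw [sum_choose_div_two_pow_eq_two_rpow_neg_tau] at hsucc
  have hlog := log_le_of_le_sqrt_pow_mul_sqrt (by positivity) (by positivity) (by positivity) hsucc
  rw [Real.log_rpow hγ, Real.log_rpow two_pos, ← mul_div_assoc, ← sub_nonneg] at hlog
  have hscaled := mul_nonneg hlog hr_pos.le
  rw [Real.log_mul (by positivity) hγ.ne', Real.log_sqrt two_pos.le]
  field_simp at hscaled ⊢
  linarith

theorem mainTheorem6 :
    ∃ c : ℝ, 1 / 2 < c ∧ c < 1 ∧ ∃ C : ℝ, 0 < C ∧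
      ∀ (m : ℕ) (X : Set (Fin m → Bool)) (f : X → Bool) (n k : ℕ), n < 2 * k → k ≤ n →
        ∀ γ : ℝ, c ≤ γ → γ < 1 →
          C * (tau n k * (randComplexityOfFun f (2 / 3) : ℝ)) ≤
            (randQueryComplexity (fun x => Thr n k (productFun f n x)) (γ ^ tau n k) : ℝ) := by
  have hsqrt : 1 < √2 * (3 / 4) := by
    have : 4 / 3 < √2 := Real.lt_sqrt_of_sq_lt (by norm_num)
    linarith
  refine ⟨3 / 4, by norm_num, by norm_num, 2 * Real.log (√2 * (3 / 4)) / 263,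
    div_pos (mul_pos two_pos (Real.log_pos hsqrt)) (by norm_num), ?_⟩
  intro m X f n k _ hk γ hγ hγ1
  refine le_trans ?_ (mainTheorem6_general f hk (by linarith) hγ1.le)
  have := tau_nonneg n k
  gcongr
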